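/- There is a constant $d$ such that for all $n,m\ge 0$ and every function $f:\{0,1\}^n\to\{0,1\}^m$ (in particular, for $m=1$, every Boolean function on $n$ inputs) there is a measurement-based quantum computation (MBQC) pattern of depth at most $d$ that implements exactly the quantum oracle $$U_f:\ |x\rangle|y\rangle\longmapsto|x\rangle|y\oplus f(x)\rangle,\qquad x\in\{0,1\}^n,\ y\in\{0,1\}^m .$$ Here a pattern (in standard form) consists of a finite set of qubits, with $n+m$ distinct input qubits and $n+m$ distinct output qubits, labelled by the positions in the registers $x,y$ (a qubit may be both an input and an output); a simple graph on the set of qubits; an angle $\alpha_u\in\mathbb R$ for every non-output qubit $u$; and, for every qubit $v$, two sets $S_v,T_v$ of non-output qubits. The dependency graph has an arrow from $u$ to $v$ whenever $u\in S_v\cup T_v$; it must have no directed cycle. The pattern is executed as follows. The input state is placed on the input qubits and every other qubit is prepared in $|+\rangle=(|0\rangle+|1\rangle)/\sqrt2$; a controlled-$Z$ is applied along each edge of the graph; each non-output qubit $u$ is measured in the basis $(|0\rangle\pm e^{i\theta_u}|1\rangle)/\sqrt2$ with $\theta_u=(-1)^{s_u}\alpha_u+t_u\pi$, giving an outcome in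 $\{0,1\}$ ($0$ for $+$, $1$ for $-$); finally $X^{s_v}Z^{t_v}$ is applied to each output qubit $v$. For each qubit $v$, $s_v$ and $t_v$ denote the sums modulo $2$ of the outcomes of the measurements of the qubits in $S_v$ and in $T_v$. The depth of the pattern is the number of qubits on a longest directed path in its dependency graph (sums modulo $2$ of classical bits are free). If $A_s$ is the linear operator from the input to the output space that corresponds to the combined outcome $s$, the pattern implements $U$ exactly if $\sum_s A_s\rho A_s^\dagger=U\rho U^\dagger$ for every operator $\rho$ on the input space. -/

import Mathlib

open scoped Matrix

noncomputable section

namespace MBQC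

/-- Classical assignments of bits to a register of qubits labelled by `ι`; they label the
computational basis of the Hilbert space of that register. -/
abbrev Bits (ι : Type) : Type := ι → Bool

/-- The `n`-qubit tensor product `⨂ᵢ A i` of one-qubit operators, in the computational basis. -/
def tensor {ι : Type} [Fintype ι] (A : ι → Matrix Bool Bool ℂ) :
    Matrix (Bits ι) (Bits ι) ℂ :=
  Matrix.of fun z w => ∏ i, A i (z i) (w i)

/-- The Pauli operator `X`, i.e. `|b⟩ ↦ |b ⊕ 1⟩`. -/
def pauliX : Matrix Bool Bool ℂ := Matrix.of fun a b => if a = !b then 1 else 0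

/-- The Pauli operator `Z`, i.e. `|b⟩ ↦ (-1)^b |b⟩`. -/
def pauliZ : Matrix Bool Bool ℂ := Matrix.diagonal fun b => if b then -1 else 1

/-- The coefficient at `|b⟩` of the state `|+⟩ = (|0⟩ + |1⟩)/√2`. -/
def ketPlus (_b : Bool) : ℂ := 1 / (Real.sqrt 2 : ℂ)

/-- The coefficient at `⟨b|` of the bra `(⟨0| + (-1)^s e^{-iθ} ⟨1|)/√2`: it is `⟨+_θ|` for the
outcome `s = 0` and `⟨-_θ|` for the outcome `s = 1` of a measurement in the basis
`|±_θ⟩ = (|0⟩ ± e^{iθ} |1⟩)/√2`. -/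
def braMeas (θ : ℝ) (s : Bool) (b : Bool) : ℂ :=
  (1 / (Real.sqrt 2 : ℂ)) *
    (if b then (if s then -1 else 1) * Complex.exp (-(Complex.I * (θ : ℂ))) else 1)

/-- The sum modulo 2 of the measurement outcomes in `S`. -/
def parity {M : Type} (S : Finset M) (s : Bits M) : Bool :=
  decide (Odd (S.filter fun u => s u = true).card)

/-- A measurement pattern in standard form, with input qubits labelled by `I` and output qubits
labelled by `O`. Its qubits are the measured ones, `M`, and the output ones, `O`; an input qubit
may be of either kind. All non-input qubits are prepared in `|+⟩`, then controlled-`Z` is applied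
along every edge of the entanglement graph, then every qubit `u` of `M` is measured in the basis
`|±_θ⟩` with `θ = (-1)^s · angle u + t · π`, and finally `X^s Z^t` is applied to every output
qubit. In each case, the signals `s` and `t` of a qubit `v` are the sums modulo 2 of the outcomes
in `xSignal v` and `zSignal v`. The dependencies have no cycle. -/
structure Pattern (I O : Type) where
  M : Type
  [fintypeM : Fintype M]
  [decEqM : DecidableEq M]
  graph : SimpleGraph (M ⊕ O)
  [decAdj : DecidableRel graph.Adj]
  input : I ↪ M ⊕ O
  angle : M → ℝ
  xSignal : M ⊕ O → Finset M
  zSignal : M ⊕ O → Finset M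
  acyclic : ∀ v : M ⊕ O, ¬ Relation.TransGen
    (fun a b : M ⊕ O => ∃ u : M, a = Sum.inl u ∧ (u ∈ xSignal b ∨ u ∈ zSignal b)) v v

namespace Pattern

attribute [instance] Pattern.fintypeM Pattern.decEqM Pattern.decAdj

variable {I O : Type} (P : Pattern I O)

/-- All the qubits of the pattern. -/
abbrev Qubit : Type := P.M ⊕ O

/-- The dependency graph: there is an arrow from `a` to `b` if the measurement of `b`, or the
correction of `b`, uses the outcome of the measurement of `a`. -/
def Dep (a b : P.Qubit) : Prop :=
  ∃ u : P.M, a = Sum.inl u ∧ (u ∈ P.xSignal b ∨ u ∈ P.zSignal b)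

/-- The depth: the number of qubits on a longest path in the dependency graph. -/
def depth : ℕ∞ :=
  ⨆ (l : List P.Qubit) (_ : l.IsChain P.Dep), (l.length : ℕ∞)

section Semantics

variable [Fintype I] [DecidableEq I] [Fintype O] [DecidableEq O]

/-- Preparation: the inputs are placed on the input qubits, all others are set to `|+⟩`. -/
def prepare : Matrix (Bits P.Qubit) (Bits I) ℂ :=
  Matrix.of fun z x =>
    if (fun i => z (P.input i)) = x then
      ∏ v ∈ Finset.univ.filter (fun v => ∀ i, P.input i ≠ v), ketPlus (z v)
    else 0

/-- Entanglement: controlled-`Z` along every edge of the graph. -/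
def entangle : Matrix (Bits P.Qubit) (Bits P.Qubit) ℂ :=
  Matrix.diagonal fun z => ∏ e ∈ P.graph.edgeFinset, if ∀ v ∈ e, z v = true then -1 else 1

/-- The angle by which the qubit `u` is measured, given the outcomes `s`. -/
def actualAngle (s : Bits P.M) (u : P.M) : ℝ :=
  (if parity (P.xSignal (Sum.inl u)) s then -P.angle u else P.angle u) +
    (if parity (P.zSignal (Sum.inl u)) s then Real.pi else 0)

/-- Measurement of all the qubits in `M`, in the branch where the outcomes are `s`. -/
def measure (s : Bits P.M) : Matrix (Bits O) (Bits P.Qubit) ℂ :=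
  Matrix.of fun y z =>
    if (fun o => z (Sum.inr o)) = y then
      ∏ u : P.M, braMeas (P.actualAngle s u) (s u) (z (Sum.inl u))
    else 0

/-- The corrections on the output qubits, in the branch where the outcomes are `s`. -/
def correct (s : Bits P.M) : Matrix (Bits O) (Bits O) ℂ :=
  tensor fun o =>
    (if parity (P.xSignal (Sum.inr o)) s then pauliX else 1) *
      (if parity (P.zSignal (Sum.inr o)) s then pauliZ else 1)

/-- The (unnormalised) operator that the pattern performs if the outcomes are `s`. -/
def branch (s : Bits P.M) : Matrix (Bits O) (Bits I) ℂ :=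
  P.correct s * P.measure s * P.entangle * P.prepare

/-- The quantum operation performed by the pattern: the sum over all branches. -/
def channel (ρ : Matrix (Bits I) (Bits I) ℂ) : Matrix (Bits O) (Bits O) ℂ :=
  ∑ s : Bits P.M, P.branch s * ρ * (P.branch s)ᴴ

/-- The pattern performs exactly the operation `ρ ↦ U ρ U†`. -/
def Implements (U : Matrix (Bits O) (Bits I) ℂ) : Prop :=
  ∀ ρ : Matrix (Bits I) (Bits I) ℂ, P.channel ρ = U * ρ * Uᴴ

end Semantics

end Pattern

/-- The map `(x, y) ↦ (x, y ⊕ f(x))`, on `n + m` bits. -/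
def oracleMap {n m : ℕ} (f : Bits (Fin n) → Bits (Fin m)) (w : Bits (Fin n ⊕ Fin m)) :
    Bits (Fin n ⊕ Fin m) :=
  Sum.elim (fun i => w (Sum.inl i))
    (fun j => xor (w (Sum.inr j)) (f (fun i => w (Sum.inl i)) j))

/-- The quantum oracle `|x⟩|y⟩ ↦ |x⟩|y ⊕ f(x)⟩`. -/
def oracle {n m : ℕ} (f : Bits (Fin n) → Bits (Fin m)) :
    Matrix (Bits (Fin n ⊕ Fin m)) (Bits (Fin n ⊕ Fin m)) ℂ :=
  Matrix.of fun z w => if z = oracleMap f w then 1 else 0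

end MBQC

end

open scoped Matrix

noncomputable section

namespace MBQC

/-! The oracle is a diagonal unitary with phase `φ(x,y) = π y·f(x)`, conjugated by Hadamard gates on
the `y`-register. Any real function on the cube is a combination `∑ c_S χ_S` of Walsh characters
(`sum_walshCoeff_mul_walsh`), so the diagonal unitary is a product of commuting factors `exp(i c_S
χ_S)`, one for each set `S` of qubits. The number of factors is exponential, but all of them act in
parallel.

Each factor is a phase gadget (`gadget_sum`): an axle joined to the members of `S`, and a leaf
joined to the axle and measured at angle `± 2 c_S`. Each Hadamard gate is one edge along a path `y_j
- w_j - o_j` with measurements at angle 0 (`hadamard_sum`), and the gadgets act on the middle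
qubits.

The outcomes at the inputs `y_j` and at the axles only flip signs of leaf angles; all other
byproducts are Pauli operators, moved to the outputs. So there are three levels: nonadaptive
measurements, leaves, outputs. Every branch equals the oracle times a scalar of squared modulus
`2^{-|M|}` (`phasePattern_branch_oracle`, `branchScalar_mul_star`), which suffices by
`implements_of_branch`. -/

/-- The sign `(-1)^b`. -/
def sgn (b : Bool) : ℂ := if b then -1 else 1

/-- The sign `(-1)^(ab)`. -/
def cz (a b : Bool) : ℂ := if b then sgn a else 1

@[simp] theorem sgn_false : sgn false = 1 := rfl

@[simp] theorem sgn_true : sgn true = -1 := rfl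

@[simp] theorem cz_false_right (a : Bool) : cz a false = 1 := rfl

@[simp] theorem cz_true_right (a : Bool) : cz a true = sgn a := rfl

theorem cz_comm (a b : Bool) : cz a b = cz b a := by
  cases a <;> cases b <;> simp

theorem norm_sgn (a : Bool) : ‖sgn a‖ = 1 := by
  cases a <;> simp

theorem norm_cz (a b : Bool) : ‖cz a b‖ = 1 := by
  cases b <;> simp [norm_sgn]

theorem sgn_xor (a b : Bool) : sgn (xor a b) = sgn a * sgn b := by
  cases a <;> cases b <;> simp

theorem sgn_mul_self (a : Bool) : sgn a * sgn a = 1 := by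
  cases a <;> simp

theorem sgn_injective : Function.Injective sgn := by
  intro a b h
  cases a <;> cases b <;> first | rfl | (norm_num at h)

theorem sgn_parity {M : Type} (S : Finset M) (s : Bits M) :
    sgn (parity S s) = ∏ u ∈ S, sgn (s u) := by
  have : ∏ u ∈ S, sgn (s u) = (-1) ^ (S.filter fun u => s u = true).card := by
    simp [sgn, Finset.prod_ite]
  rw [this]
  by_cases h : Odd (S.filter fun u => s u = true).card
  · simp [parity, h, h.neg_one_pow]
  · simp [parity, h, (Nat.not_odd_iff_even.mp h).neg_one_pow]

theorem cz_parity_left {M : Type} (S : Finset M) (s : Bits M) (a : Bool) :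
    cz (parity S s) a = ∏ u ∈ S, cz (s u) a := by
  cases a <;> simp [sgn_parity]

theorem cz_parity_right {M : Type} (S : Finset M) (s : Bits M) (a : Bool) :
    cz a (parity S s) = ∏ u ∈ S, cz a (s u) := by
  rw [cz_comm, cz_parity_left]
  exact Finset.prod_congr rfl fun u _ => cz_comm _ _

/-! ### Walsh expansion of real functions on the cube. -/

/-- The Walsh character of `S`, with real values. -/
def walsh {K : Type} (S : Finset K) (z : Bits K) : ℝ := ∏ k ∈ S, if z k then -1 else 1

theorem coe_walsh {K : Type} (S : Finset K) (z : Bits K) :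
    (walsh S z : ℂ) = sgn (parity S z) := by
  rw [sgn_parity, walsh, Complex.ofReal_prod]
  exact Finset.prod_congr rfl fun k _ => by cases z k <;> simp

theorem walsh_xor {K : Type} (S : Finset K) (z w : Bits K) :
    walsh S (fun k => xor (z k) (w k)) = walsh S z * walsh S w := by
  rw [walsh, walsh, walsh, ← Finset.prod_mul_distrib]
  exact Finset.prod_congr rfl fun k _ => by cases z k <;> cases w k <;> simp

/-- The sum over `S` of `∏_{k ∈ S} ε_k` is `∏_k (1 + ε_k)`; here `ε_k = -1` exactly where `z` and
`w` differ, and one such `k` kills the product. -/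
theorem sum_walsh_mul_walsh {K : Type} [Fintype K] [DecidableEq K] (z w : Bits K) :
    ∑ S : Finset K, walsh S z * walsh S w = if z = w then 2 ^ Fintype.card K else 0 := by
  simp_rw [← walsh_xor]
  unfold walsh
  rw [← Finset.powerset_univ, ← Finset.prod_one_add]
  split_ifs with h
  · subst h
    simp only [bne_self_eq_false, Bool.false_eq_true, if_false]
    norm_num [Finset.card_univ]
  · obtain ⟨k, hk⟩ := Function.ne_iff.mp h
    refine Finset.prod_eq_zero (Finset.mem_univ k) ?_
    have : xor (z k) (w k) = true := by simpa using hk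
    rw [if_pos this]
    norm_num

/-- The Walsh coefficient of `g` at `S`. -/
def walshCoeff {K : Type} [Fintype K] [DecidableEq K] (g : Bits K → ℝ) (S : Finset K) : ℝ :=
  (∑ z, g z * walsh S z) / 2 ^ Fintype.card K

theorem sum_walshCoeff_mul_walsh {K : Type} [Fintype K] [DecidableEq K] (g : Bits K → ℝ)
    (w : Bits K) : ∑ S, walshCoeff g S * walsh S w = g w := by
  have h : ∀ S, walshCoeff g S * walsh S w =
      (∑ z, g z * (walsh S z * walsh S w)) / 2 ^ Fintype.card K := by
    intro S
    rw [walshCoeff, div_mul_eq_mul_div, Finset.sum_mul]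
    simp_rw [mul_assoc]
  simp_rw [h]
  rw [← Finset.sum_div, Finset.sum_comm]
  simp_rw [← Finset.mul_sum, sum_walsh_mul_walsh]
  simp

/-! ### Entrywise formulas for corrections, measurements and edges. -/

/-- A one-qubit gate correction, entrywise. -/
theorem correction_apply (p q a b : Bool) :
    ((if p then pauliX else 1) * (if q then pauliZ else 1) : Matrix Bool Bool ℂ) a b =
      if b = xor a p then cz q b else 0 := by
  cases p <;> cases q <;> cases a <;> cases b <;>
    simp [pauliX, pauliZ, Matrix.mul_apply, Matrix.one_apply, Matrix.diagonal_apply]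

theorem braMeas_eq (θ : ℝ) (s b : Bool) :
    braMeas θ s b = (1 / (Real.sqrt 2 : ℂ)) *
      (cz s b * if b then Complex.exp (-(Complex.I * (θ : ℂ))) else 1) := by
  cases b <;> simp [braMeas, sgn]

/-- The product over the edges of a graph whose edges are oriented by a rank function. -/
theorem prod_edgeFinset_of_rank {V : Type} [Fintype V] [DecidableEq V]
    (G : SimpleGraph V) [Fintype G.edgeSet] (R : V → V → Prop) [DecidableRel R] (rank : V → ℕ)
    (hrank : ∀ u v, R u v → rank u < rank v) (hG : ∀ u v, G.Adj u v ↔ R u v ∨ R v u)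
    (F : Sym2 V → ℂ) :
    ∏ e ∈ G.edgeFinset, F e = ∏ u, ∏ v, if R u v then F s(u, v) else 1 := by
  have h : ∀ u, (∏ v, if R u v then F s(u, v) else 1) =
      ∏ v ∈ Finset.univ.filter (R u), F s(u, v) := fun u => (Finset.prod_filter _ _).symm
  simp_rw [h]
  rw [Finset.prod_sigma']
  symm
  refine Finset.prod_bij (fun p _ => s(p.1, p.2)) ?_ ?_ ?_ ?_
  · rintro ⟨u, v⟩ huv
    simp only [Finset.mem_sigma, Finset.mem_univ, Finset.mem_filter, true_and] at huv
    simp [hG, huv]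
  · rintro ⟨u, v⟩ huv ⟨u', v'⟩ huv' he
    simp only [Finset.mem_sigma, Finset.mem_univ, Finset.mem_filter, true_and] at huv huv'
    rcases Sym2.eq_iff.mp he with ⟨h1, h2⟩ | ⟨h1, h2⟩
    · simp only at h1 h2
      subst h1; subst h2; rfl
    -- An edge oriented both ways would have `rank u < rank v < rank u`.
    · simp only at h1 h2
      subst h1; subst h2
      exact absurd (hrank _ _ huv) (hrank _ _ huv').asymm
  · intro e
    induction e with
    | _ u v =>
      intro he
      rw [SimpleGraph.mem_edgeFinset, SimpleGraph.mem_edgeSet, hG] at he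
      rcases he with he | he
      · exact ⟨⟨u, v⟩, by simpa using he, rfl⟩
      · exact ⟨⟨v, u⟩, by simpa using he, Sym2.eq_swap⟩
  · intros; rfl

theorem sum_bits_sum {A B : Type} [Fintype A] [Fintype B] [DecidableEq A] [DecidableEq B]
    (F : Bits (A ⊕ B) → ℂ) : ∑ z, F z = ∑ a : Bits A, ∑ b : Bits B, F (Sum.elim a b) := by
  rw [← Fintype.sum_prod_type']
  exact Fintype.sum_equiv (Equiv.sumArrowEquivProdArrow A B Bool) _ _
    fun z => by simp [Equiv.sumArrowEquivProdArrow]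

/-! ### Depth and branch operators of an arbitrary pattern. -/

namespace Pattern

variable {I O : Type} (P : Pattern I O)

/-- A rank function on the qubits that increases along dependencies bounds the depth. -/
theorem depth_le_of_rank (d : ℕ) (rank : P.Qubit → ℕ) (hd : ∀ v, rank v < d)
    (hrank : ∀ a b, P.Dep a b → rank a < rank b) : P.depth ≤ d := by
  refine iSup₂_le fun l hl => ?_
  have h1 : (l.map rank).IsChain (· < ·) := by
    rw [List.isChain_map]
    exact hl.imp fun a b h => hrank a b h
  have h2 : (l.map rank).Nodup := (List.isChain_iff_pairwise.mp h1).imp fun h => h.ne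
  have h3 : (l.map rank) ⊆ List.range d := by
    intro k hk
    obtain ⟨v, -, rfl⟩ := List.mem_map.mp hk
    exact List.mem_range.mpr (hd v)
  have h4 := (List.subperm_of_subset h2 h3).length_le
  simp only [List.length_map, List.length_range] at h4
  exact_mod_cast h4

theorem correct_apply [Fintype O] (s : Bits P.M) (out o : Bits O) :
    P.correct s out o =
      if o = fun k => xor (out k) (parity (P.xSignal (Sum.inr k)) s) then
        ∏ k, cz (parity (P.zSignal (Sum.inr k)) s) (o k) else 0 := by
  simp only [correct, tensor, Matrix.of_apply, correction_apply]
  rw [Finset.prod_ite_zero]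
  simp [funext_iff]

/-- With as many inputs as outputs, there are as many prepared qubits as measured ones. -/
theorem prod_ketPlus [Fintype I] [Fintype O] [DecidableEq O]
    (hcard : Fintype.card I = Fintype.card O) (z : Bits P.Qubit) :
    ∏ v ∈ Finset.univ.filter (fun v => ∀ i, P.input i ≠ v), ketPlus (z v) =
      (1 / (Real.sqrt 2 : ℂ)) ^ Fintype.card P.M := by
  have h : Finset.univ.filter (fun v => ∀ i, P.input i ≠ v) =
      (Finset.univ.map P.input)ᶜ := by
    ext v; simp
  have hc : (Finset.univ.filter (fun v => ∀ i, P.input i ≠ v)).card = Fintype.card P.M := by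
    rw [h, Finset.card_compl, Finset.card_map, Finset.card_univ, Fintype.card_sum, hcard]
    omega
  simp only [ketPlus, Finset.prod_const, hc]

theorem branch_apply [Fintype I] [Fintype O] [DecidableEq O]
    (hcard : Fintype.card I = Fintype.card O) (s : Bits P.M)
    (out : Bits O) (x : Bits I) :
    P.branch s out x = ∑ z : Bits P.Qubit,
      P.correct s out (fun o => z (Sum.inr o)) *
        (∏ u : P.M, braMeas (P.actualAngle s u) (s u) (z (Sum.inl u))) *
        (∏ e ∈ P.graph.edgeFinset, if ∀ v ∈ e, z v = true then -1 else 1) *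
        (if (fun i => z (P.input i)) = x then (1 / (Real.sqrt 2 : ℂ)) ^ Fintype.card P.M
          else 0) := by
  rw [branch, Matrix.mul_apply]
  refine Finset.sum_congr rfl fun z _ => ?_
  rw [entangle, Matrix.mul_diagonal, Matrix.mul_apply]
  simp only [measure, prepare, Matrix.of_apply, mul_ite, mul_zero, Finset.sum_ite_eq,
    Finset.mem_univ, if_true, prod_ketPlus P hcard]

/-- A pattern implements `U` if all branches are proportional to `U`, with equal weights. -/
theorem implements_of_branch [Fintype I] [DecidableEq I] [Fintype O] [DecidableEq O]
    (U : Matrix (Bits O) (Bits I) ℂ)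
    (h : ∀ s, ∃ c : ℂ, c * star c = (1 / 2) ^ Fintype.card P.M ∧ P.branch s = c • U) :
    P.Implements U := by
  intro ρ
  have h1 : ∀ s, P.branch s * ρ * (P.branch s)ᴴ =
      ((1 / 2 : ℂ) ^ Fintype.card P.M) • (U * ρ * Uᴴ) := by
    intro s
    obtain ⟨c, hc, hb⟩ := h s
    rw [hb, Matrix.conjTranspose_smul, Matrix.smul_mul, Matrix.smul_mul, Matrix.mul_smul,
      smul_smul, hc]
  -- There are `2^|M|` branches, each of weight `2^{-|M|}`.
  rw [channel, Finset.sum_congr rfl fun s _ => h1 s, Finset.sum_const, Finset.card_univ,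
    Fintype.card_fun, Fintype.card_bool, ← Nat.cast_smul_eq_nsmul ℂ, smul_smul]
  simp

end Pattern

/-! ### The phase pattern: qubits, edges, dependencies and depth. -/

section

open scoped Classical in
/-- The factor `z` if `p` holds, and `1` otherwise. -/
def factorIf (p : Prop) (z : ℂ) : ℂ := if p then z else 1

/-- Replaces whichever decidability instance is present by the classical one, so that the conditions
can be rewritten freely. -/
theorem ite_one_eq_factorIf (p : Prop) [Decidable p] (z : ℂ) :
    (if p then z else 1) = factorIf p z := by
  by_cases h : p <;> simp [factorIf, h]

theorem factorIf_false (z : ℂ) : factorIf False z = 1 := if_neg id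

theorem factorIf_true (z : ℂ) : factorIf True z = z := if_pos trivial

theorem factorIf_one (p : Prop) : factorIf p 1 = 1 := ite_self _

theorem prod_factorIf_eq {A : Type} [Fintype A] (j : A) (f : A → ℂ) :
    ∏ k, factorIf (k = j) (f k) = f j := by
  rw [Fintype.prod_eq_single j fun k hk => by simp [hk, factorIf_false]]
  simp [factorIf_true]

theorem prod_factorIf_eq' {A : Type} [Fintype A] (j : A) (f : A → ℂ) :
    ∏ k, factorIf (j = k) (f k) = f j := by
  rw [Fintype.prod_eq_single j fun k hk => by simp [hk.symm, factorIf_false]]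
  simp [factorIf_true]

/-- The measured qubits of the phase pattern: the inputs `y`, a second copy of that register, and
for each parity an axle and a leaf. -/
abbrev PhaseMeas (n m : ℕ) : Type :=
  (Fin m ⊕ Fin m) ⊕ (Finset (Fin n ⊕ Fin m) ⊕ Finset (Fin n ⊕ Fin m))

variable {n m : ℕ}

/-- The edges of the phase pattern, with an orientation. -/
def PhaseEdge : PhaseMeas n m ⊕ (Fin n ⊕ Fin m) → PhaseMeas n m ⊕ (Fin n ⊕ Fin m) → Prop
  | .inl (.inl (.inl j)), .inl (.inl (.inr k)) => j = k
  | .inl (.inl (.inr j)), .inr (.inr k) => j = k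
  | .inl (.inr (.inl S)), .inl (.inr (.inr T)) => S = T
  -- Axles meet the second copy of the `y`-register, which sits between the two Hadamard gates.
  | .inl (.inr (.inl S)), .inl (.inl (.inr k)) => Sum.inr k ∈ S
  | .inl (.inr (.inl S)), .inr (.inl i) => Sum.inl i ∈ S
  | _, _ => False

/-- A rank function on the qubits that increases along the oriented edges. -/
def phaseEdgeRank : PhaseMeas n m ⊕ (Fin n ⊕ Fin m) → ℕ
  | .inl (.inl (.inl _)) => 0
  | .inl (.inr (.inl _)) => 0
  | .inl (.inl (.inr _)) => 1
  | .inl (.inr (.inr _)) => 1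
  | .inr _ => 2

theorem phaseEdgeRank_lt (u v : PhaseMeas n m ⊕ (Fin n ⊕ Fin m)) (h : PhaseEdge u v) :
    phaseEdgeRank u < phaseEdgeRank v := by
  rcases u with ((j | j) | (S | S)) | (i | j) <;> rcases v with ((k | k) | (T | T)) | (i' | k) <;>
    simp_all [PhaseEdge, phaseEdgeRank]

/-- The dependencies of the signs of the angles and of the `X`-corrections. -/
def PhaseXDep : PhaseMeas n m → PhaseMeas n m ⊕ (Fin n ⊕ Fin m) → Prop
  -- Outcome 1 at `y_j` leaves an `X` on `w_j`, which negates `χ_S` for every `S` containing that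
  -- position.
  | .inl (.inl j), .inl (.inr (.inr S)) => Sum.inr j ∈ S
  | .inr (.inl T), .inl (.inr (.inr S)) => T = S
  -- Both of these are `Z`-byproducts at the middle qubit, turned into `X` by the second Hadamard
  -- gate.
  | .inl (.inr j), .inr (.inr k) => j = k
  | .inr (.inr S), .inr (.inr k) => Sum.inr k ∈ S
  | _, _ => False

/-- The dependencies of the `Z`-corrections. -/
def PhaseZDep : PhaseMeas n m → PhaseMeas n m ⊕ (Fin n ⊕ Fin m) → Prop
  -- The `X` on the middle qubit becomes `Z` after the second Hadamard gate; on the `x`-register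
  -- there is no such gate and the `Z` of a leaf stays `Z`.
  | .inl (.inl j), .inr (.inr k) => j = k
  | .inr (.inr S), .inr (.inl i) => Sum.inl i ∈ S
  | _, _ => False

/-- A rank function on the qubits that increases along the dependencies. -/
def phaseDepRank : PhaseMeas n m ⊕ (Fin n ⊕ Fin m) → ℕ
  | .inl (.inr (.inr _)) => 1
  | .inl _ => 0
  | .inr _ => 2

theorem phaseDepRank_lt (u : PhaseMeas n m) (v : PhaseMeas n m ⊕ (Fin n ⊕ Fin m))
    (h : PhaseXDep u v ∨ PhaseZDep u v) : phaseDepRank (Sum.inl u) < phaseDepRank v := by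
  rcases u with (j | j) | (S | S) <;> rcases v with ((k | k) | (T | T)) | (i' | k) <;>
    simp_all [PhaseXDep, PhaseZDep, phaseDepRank]

theorem phaseDepRank_lt_three (v : PhaseMeas n m ⊕ (Fin n ⊕ Fin m)) : phaseDepRank v < 3 := by
  rcases v with ((k | k) | (T | T)) | (i' | k) <;> simp [phaseDepRank]

/-- The entanglement graph of the phase pattern. -/
def phaseGraph (n m : ℕ) : SimpleGraph (PhaseMeas n m ⊕ (Fin n ⊕ Fin m)) where
  Adj u v := PhaseEdge u v ∨ PhaseEdge v u
  symm := ⟨fun _ _ h => h.symm⟩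
  loopless := ⟨fun u h => (h.elim (phaseEdgeRank_lt u u) (phaseEdgeRank_lt u u)).false⟩

instance : DecidableRel (phaseGraph n m).Adj := Classical.decRel _

open scoped Classical in
/-- The qubits whose outcomes determine the sign of the angle, or the `X`-correction, of `v`. -/
def phaseXSignal (v : PhaseMeas n m ⊕ (Fin n ⊕ Fin m)) : Finset (PhaseMeas n m) :=
  Finset.univ.filter fun u => PhaseXDep u v

open scoped Classical in
/-- The qubits whose outcomes determine the `Z`-correction of `v`. -/
def phaseZSignal (v : PhaseMeas n m ⊕ (Fin n ⊕ Fin m)) : Finset (PhaseMeas n m) :=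
  Finset.univ.filter fun u => PhaseZDep u v

theorem phaseDepRank_lt_of_mem {u : PhaseMeas n m} {v : PhaseMeas n m ⊕ (Fin n ⊕ Fin m)}
    (h : u ∈ phaseXSignal v ∨ u ∈ phaseZSignal v) :
    phaseDepRank (Sum.inl u) < phaseDepRank v :=
  phaseDepRank_lt u v (by simpa [phaseXSignal, phaseZSignal] using h)

/-- The pattern that conjugates the diagonal unitary `exp(i ∑_S c_S χ_S)` with Hadamard gates on
the second register. -/
abbrev phasePattern (n m : ℕ) (c : Finset (Fin n ⊕ Fin m) → ℝ) :
    Pattern (Fin n ⊕ Fin m) (Fin n ⊕ Fin m) where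
  M := PhaseMeas n m
  graph := phaseGraph n m
  input :=
    { toFun := Sum.elim (fun i => .inr (.inl i)) fun j => .inl (.inl (.inl j))
      inj' := by rintro (i | i) (j | j) h <;> simp_all }
  -- The factor 2 is the gap between the phases `c_S` and `-c_S` of the two values of `χ_S`.
  angle := Sum.elim (fun _ => 0) (Sum.elim (fun _ => 0) fun S => 2 * c S)
  xSignal := phaseXSignal
  zSignal := phaseZSignal
  acyclic v h := by
    have key : ∀ a b : PhaseMeas n m ⊕ (Fin n ⊕ Fin m), Relation.TransGen
        (fun a b => ∃ u : PhaseMeas n m, a = Sum.inl u ∧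
          (u ∈ phaseXSignal b ∨ u ∈ phaseZSignal b)) a b → phaseDepRank a < phaseDepRank b := by
      intro a b hab
      induction hab with
      | single h =>
        obtain ⟨u, rfl, hu⟩ := h
        exact phaseDepRank_lt_of_mem hu
      | tail _ h ih =>
        obtain ⟨u, rfl, hu⟩ := h
        exact ih.trans (phaseDepRank_lt_of_mem hu)
    exact (key v v h).false

variable (c : Finset (Fin n ⊕ Fin m) → ℝ)

theorem phasePattern_depth : (phasePattern n m c).depth ≤ 3 := by
  refine (phasePattern n m c).depth_le_of_rank 3 phaseDepRank phaseDepRank_lt_three ?_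
  rintro a b ⟨u, rfl, hu⟩
  exact phaseDepRank_lt_of_mem hu

theorem card_phaseMeas :
    Fintype.card (PhaseMeas n m) = 2 * (m + Fintype.card (Finset (Fin n ⊕ Fin m))) := by
  simp only [PhaseMeas, Fintype.card_sum, Fintype.card_fin]
  ring

/-- The outcomes of the four groups of measurements. -/
def outcomes (sY sW : Bits (Fin m)) (sA sB : Bits (Finset (Fin n ⊕ Fin m))) :
    Bits (PhaseMeas n m) :=
  Sum.elim (Sum.elim sY sW) (Sum.elim sA sB)

theorem exists_eq_outcomes (s : Bits (PhaseMeas n m)) :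
    ∃ sY sW sA sB, s = outcomes sY sW sA sB :=
  ⟨_, _, _, _, funext fun u => by rcases u with (j | j) | (S | S) <;> rfl⟩

/-! ### Signals and actual angles for given outcomes. -/

variable (sY sW : Bits (Fin m)) (sA sB : Bits (Finset (Fin n ⊕ Fin m)))

/-- The parity of the outcomes of the leaves whose parities contain `k`. -/
def leafParity (k : Fin n ⊕ Fin m) : Bool :=
  parity (Finset.univ.filter fun S : Finset (Fin n ⊕ Fin m) => k ∈ S) sB

theorem xSignal_inl (i : Fin n) :
    parity (phaseXSignal (Sum.inr (Sum.inl i))) (outcomes sY sW sA sB) = false := by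
  apply sgn_injective
  rw [sgn_parity, phaseXSignal]
  simp [PhaseXDep]

theorem xSignal_inr (j : Fin m) :
    parity (phaseXSignal (Sum.inr (Sum.inr j))) (outcomes sY sW sA sB) =
      xor (sW j) (leafParity sB (Sum.inr j)) := by
  apply sgn_injective
  rw [sgn_parity, sgn_xor, leafParity, sgn_parity, phaseXSignal]
  simp only [Finset.prod_filter, Fintype.prod_sum_type, ite_one_eq_factorIf]
  simp [PhaseXDep, outcomes, factorIf_false, prod_factorIf_eq]

theorem zSignal_inl (i : Fin n) :
    parity (phaseZSignal (Sum.inr (Sum.inl i))) (outcomes sY sW sA sB) =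
      leafParity sB (Sum.inl i) := by
  apply sgn_injective
  rw [sgn_parity, leafParity, sgn_parity, phaseZSignal]
  simp only [Finset.prod_filter, Fintype.prod_sum_type, ite_one_eq_factorIf]
  simp [PhaseZDep, outcomes, factorIf_false]

theorem zSignal_inr (j : Fin m) :
    parity (phaseZSignal (Sum.inr (Sum.inr j))) (outcomes sY sW sA sB) = sY j := by
  apply sgn_injective
  rw [sgn_parity, phaseZSignal]
  simp only [Finset.prod_filter, Fintype.prod_sum_type, ite_one_eq_factorIf]
  simp [PhaseZDep, outcomes, factorIf_false, prod_factorIf_eq]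

theorem zSignal_measured (u : PhaseMeas n m) (s : Bits (PhaseMeas n m)) :
    parity (phaseZSignal (Sum.inl u)) s = false := by
  apply sgn_injective
  rw [sgn_parity, phaseZSignal]
  simp [PhaseZDep]

theorem xSignal_leaf (S : Finset (Fin n ⊕ Fin m)) :
    sgn (parity (phaseXSignal (Sum.inl (Sum.inr (Sum.inr S)))) (outcomes sY sW sA sB)) =
      sgn (sA S) * (walsh S (Sum.elim (fun _ => false) sY) : ℝ) := by
  -- Writing `S` as a filter of `univ` lets its product split over the two registers, like the
  -- product over the signal set.
  rw [sgn_parity, coe_walsh, sgn_parity, mul_comm, phaseXSignal, ← Finset.filter_univ_mem S]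
  simp only [Finset.prod_filter, Fintype.prod_sum_type, ite_one_eq_factorIf]
  simp [PhaseXDep, outcomes, factorIf_false, factorIf_one, prod_factorIf_eq]

theorem actualAngle_leaf (S : Finset (Fin n ⊕ Fin m)) :
    (((phasePattern n m c).actualAngle (outcomes sY sW sA sB) (Sum.inr (Sum.inr S)) : ℝ) : ℂ) =
      sgn (sA S) * (2 * (walsh S (Sum.elim (fun _ => false) sY) * c S : ℝ)) := by
  have h : ∀ (b : Bool) (x : ℝ), ((if b then -x else x : ℝ) : ℂ) = sgn b * x := by
    intro b x
    cases b <;> simp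
  rw [Pattern.actualAngle, zSignal_measured, Complex.ofReal_add, h, xSignal_leaf]
  simp only [Bool.false_eq_true, if_false, Complex.ofReal_zero, add_zero, Sum.elim_inr]
  push_cast
  ring

theorem actualAngle_inl (j : Fin m ⊕ Fin m) :
    (phasePattern n m c).actualAngle (outcomes sY sW sA sB) (Sum.inl j) = 0 := by
  rw [Pattern.actualAngle, zSignal_measured]
  simp

theorem actualAngle_axle (S : Finset (Fin n ⊕ Fin m)) :
    (phasePattern n m c).actualAngle (outcomes sY sW sA sB) (Sum.inr (Sum.inl S)) = 0 := by
  rw [Pattern.actualAngle, zSignal_measured]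
  simp

/-! ### The factors of a branch amplitude. -/

/-- The assignment of bits to all the qubits that is given on each group of qubits. -/
def assign (y w : Bits (Fin m)) (a b : Bits (Finset (Fin n ⊕ Fin m))) (x : Bits (Fin n))
    (o : Bits (Fin m)) : Bits (PhaseMeas n m ⊕ (Fin n ⊕ Fin m)) :=
  Sum.elim (Sum.elim (Sum.elim y w) (Sum.elim a b)) (Sum.elim x o)

variable (y w : Bits (Fin m)) (a b : Bits (Finset (Fin n ⊕ Fin m))) (x : Bits (Fin n))
    (o : Bits (Fin m))

/-- The edges from an axle to the members of `S` multiply to a single controlled-`Z` with the parity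
of `S`. The instances are arbitrary, to match those arising from `Pattern.branch_apply`. -/
theorem phaseGraph_prod_edges [Fintype (phaseGraph n m).edgeSet]
    [DecidablePred fun e : Sym2 (PhaseMeas n m ⊕ (Fin n ⊕ Fin m)) =>
      ∀ v ∈ e, assign y w a b x o v = true] :
    (∏ e ∈ (phaseGraph n m).edgeFinset,
      if ∀ v ∈ e, assign y w a b x o v = true then (-1 : ℂ) else 1) =
    (∏ j, cz (y j) (w j) * cz (w j) (o j)) *
      ∏ S, cz (a S) (b S) * cz (a S) (parity S (Sum.elim x w)) := by
  classical
  rw [prod_edgeFinset_of_rank _ PhaseEdge phaseEdgeRank phaseEdgeRank_lt (fun u v => Iff.rfl)]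
  have h : ∀ u v : PhaseMeas n m ⊕ (Fin n ⊕ Fin m),
      (if ∀ t ∈ s(u, v), assign y w a b x o t = true then (-1 : ℂ) else 1) =
        cz (assign y w a b x o u) (assign y w a b x o v) := by
    intro u v
    simp only [Sym2.mem_iff, forall_eq_or_imp, forall_eq]
    cases assign y w a b x o u <;> cases assign y w a b x o v <;> simp
  simp_rw [h]
  have h2 : ∀ (d : Bool) (S : Finset (Fin n ⊕ Fin m)), cz d (parity S (Sum.elim x w)) =
      (∏ i, factorIf (Sum.inl i ∈ S) (cz d (x i))) *
        ∏ j, factorIf (Sum.inr j ∈ S) (cz d (w j)) := by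
    intro d S
    rw [cz_parity_right, ← Finset.filter_univ_mem S, Finset.prod_filter, Fintype.prod_sum_type]
    simp [ite_one_eq_factorIf]
  simp_rw [h2]
  simp only [Fintype.prod_sum_type, ite_one_eq_factorIf]
  simp only [PhaseEdge, Finset.prod_mul_distrib, assign, Sum.elim_inl, Sum.elim_inr,
    factorIf_false, prod_factorIf_eq', Finset.prod_const_one, one_mul, mul_one]
  ring

theorem phasePattern_prod_braMeas :
    (∏ u : (phasePattern n m c).M,
      braMeas ((phasePattern n m c).actualAngle (outcomes sY sW sA sB) u)
        (outcomes sY sW sA sB u) (assign y w a b x o (Sum.inl u))) =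
    (1 / (Real.sqrt 2 : ℂ)) ^ Fintype.card (PhaseMeas n m) *
      ((∏ j, cz (sY j) (y j) * cz (sW j) (w j)) *
        ∏ S, cz (sA S) (a S) * (cz (sB S) (b S) * if b S then
          Complex.exp (-(Complex.I * (sgn (sA S) *
            (2 * (walsh S (Sum.elim (fun _ => false) sY) * c S : ℝ))))) else 1)) := by
  simp_rw [braMeas_eq]
  rw [Finset.prod_mul_distrib, Finset.prod_const, Finset.card_univ]
  congr 1
  change ∏ u : PhaseMeas n m, _ = _
  simp only [PhaseMeas, Fintype.prod_sum_type, actualAngle_leaf, actualAngle_inl,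
    actualAngle_axle]
  simp only [outcomes, assign, Finset.prod_mul_distrib, Sum.elim_inl, Sum.elim_inr,
    Complex.ofReal_zero, mul_zero, neg_zero, Complex.exp_zero, ite_self, mul_one]
  ring_nf

theorem phasePattern_correct (out : Bits (Fin n ⊕ Fin m)) :
    (phasePattern n m c).correct (outcomes sY sW sA sB) out (Sum.elim x o) =
      if x = (fun i => out (Sum.inl i)) ∧
          o = (fun j => xor (out (Sum.inr j)) (xor (sW j) (leafParity sB (Sum.inr j)))) then
        (∏ i, cz (leafParity sB (Sum.inl i)) (x i)) * ∏ j, cz (sY j) (o j) else 0 := by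
  rw [Pattern.correct_apply]
  simp only [funext_iff, Sum.forall, Fintype.prod_sum_type, xSignal_inl, xSignal_inr,
    zSignal_inl, zSignal_inr]
  simp

theorem phasePattern_input (v : Bits (Fin n ⊕ Fin m)) :
    (fun i => assign y w a b x o ((phasePattern n m c).input i)) = v ↔
      y = (fun j => v (Sum.inr j)) ∧ x = fun i => v (Sum.inl i) := by
  simp only [funext_iff, Sum.forall]
  rw [and_comm]
  rfl

end

/-! ### Summing the amplitudes: gadgets and Hadamard gates. -/

section

/-- The sum over the axle bit `a` forces `b = r ⊕ sa`. Since `2b = 1 - sgn r * sgn sa`, the leaf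
phase becomes `exp(iτ sgn r)` times a scalar independent of `r`: the sign of the angle compensates
for `sa`. The outcome `sb` leaves `(-1)^{sb·r}`, a `Z` on each member of `S`. -/
theorem gadget_sum (sa sb r : Bool) (τ : ℂ) :
    ∑ a : Bool, ∑ b : Bool, cz a b * cz a r * (cz sa a * (cz sb b * if b then
      Complex.exp (-(Complex.I * (sgn sa * (2 * τ)))) else 1)) =
    2 * (Complex.exp (-(Complex.I * (sgn sa * τ))) * cz sb sa) *
      (cz sb r * Complex.exp (Complex.I * (τ * sgn r))) := by
  have h1 : Complex.exp (Complex.I * τ) * Complex.exp (-(Complex.I * τ)) = 1 := by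
    rw [← Complex.exp_add]; simp
  have h2 : Complex.exp (-(Complex.I * (2 * τ))) = Complex.exp (-(Complex.I * τ)) ^ 2 := by
    rw [← Complex.exp_nat_mul]; congr 1; push_cast; ring
  have h3 : Complex.exp (Complex.I * (2 * τ)) = Complex.exp (Complex.I * τ) ^ 2 := by
    rw [← Complex.exp_nat_mul]; congr 1; push_cast; ring
  cases sa <;> cases sb <;> cases r <;>
    simp only [Fintype.sum_bool, cz, sgn, if_true, Bool.false_eq_true, if_false, one_mul, mul_one,
      neg_mul, mul_neg, neg_neg, h2, h3] <;>
    first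
    | ring1
    | linear_combination (2 : ℂ) * h1
    | linear_combination (-2 : ℂ) * h1

/-- The exponent of `-1` is linear in `w` with coefficient `y + q + f`, as the corrections cancel
`sW` and `B`. Hence the sum vanishes unless `q = y ⊕ f`, and then only a sign independent of `y` and
`f` remains. -/
theorem hadamard_sum (y q sY sW B f : Bool) :
    cz sY (xor q (xor sW B)) * cz sY y * ∑ w : Bool,
      cz y w * cz w (xor q (xor sW B)) * cz sW w * cz B w * cz f (xor w sY) =
    if q = xor y f then 2 * cz sY (xor sW B) else 0 := by
  cases y <;> cases q <;> cases sY <;> cases sW <;> cases B <;> cases f <;>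
    norm_num [cz, sgn]

variable {n m : ℕ} (c : Finset (Fin n ⊕ Fin m) → ℝ)
variable (sY sW : Bits (Fin m)) (sA sB : Bits (Finset (Fin n ⊕ Fin m)))

/-- Collects the `Z`-byproducts of all leaves qubit by qubit. -/
theorem prod_cz_parity (z : Bits (Fin n ⊕ Fin m)) :
    ∏ S, cz (sB S) (parity S z) = ∏ k, cz (leafParity sB k) (z k) := by
  simp_rw [leafParity, cz_parity_left, cz_parity_right]
  exact Finset.prod_comm' (by simp)

/-- The angle that the phase gadget of `S` contributes. -/
def gadgetAngle (S : Finset (Fin n ⊕ Fin m)) : ℝ :=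
  walsh S (Sum.elim (fun _ => false) sY) * c S

/-- Since characters are multiplicative, the adapted signs shift the argument of the phase by `sY`,
undoing the `X`-byproducts on the second copy. -/
theorem prod_exp_gadgetAngle (z : Bits (Fin n ⊕ Fin m)) :
    ∏ S, Complex.exp (Complex.I * (gadgetAngle c sY S * sgn (parity S z))) =
      Complex.exp (Complex.I * (∑ S, c S *
        walsh S (fun k => xor (z k) (Sum.elim (fun _ => false) sY k)) : ℝ)) := by
  rw [← Complex.exp_sum, ← Finset.mul_sum, Complex.ofReal_sum]
  congr 2
  refine Finset.sum_congr rfl fun S _ => ?_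
  rw [← coe_walsh, walsh_xor, gadgetAngle]
  push_cast
  ring

theorem phasePattern_branch (out v : Bits (Fin n ⊕ Fin m)) :
    (phasePattern n m c).branch (outcomes sY sW sA sB) out v =
      if (fun i => out (Sum.inl i)) = fun i => v (Sum.inl i) then
        (1 / 2) ^ Fintype.card (PhaseMeas n m) *
        (∏ i, cz (leafParity sB (Sum.inl i)) (v (Sum.inl i))) *
        (∏ j, cz (sY j) (xor (out (Sum.inr j)) (xor (sW j) (leafParity sB (Sum.inr j)))) *
          cz (sY j) (v (Sum.inr j))) *
        ∑ w : Bits (Fin m), (∏ j, cz (v (Sum.inr j)) (w j) *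
          cz (w j) (xor (out (Sum.inr j)) (xor (sW j) (leafParity sB (Sum.inr j)))) *
          cz (sW j) (w j)) *
          ∏ S, (2 * (Complex.exp (-(Complex.I * (sgn (sA S) * gadgetAngle c sY S))) *
            cz (sB S) (sA S)) *
            (cz (sB S) (parity S (Sum.elim (fun i => v (Sum.inl i)) w)) *
              Complex.exp (Complex.I * (gadgetAngle c sY S *
                sgn (parity S (Sum.elim (fun i => v (Sum.inl i)) w))))))
      else 0 := by
  rw [Pattern.branch_apply _ rfl]
  simp_rw [sum_bits_sum]
  set o : Bits (Fin m) :=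
    fun j => xor (out (Sum.inr j)) (xor (sW j) (leafParity sB (Sum.inr j))) with ho
  have hhalf : (1 / (Real.sqrt 2 : ℂ)) * (1 / (Real.sqrt 2 : ℂ)) = 1 / 2 := by
    rw [div_mul_div_comm, ← Complex.ofReal_mul, Real.mul_self_sqrt zero_le_two]
    norm_num
  -- Inputs and corrections fix `y`, `x` and `o'`; only `w` and the gadget bits stay free.
  trans ∑ y : Bits (Fin m), ∑ w : Bits (Fin m), ∑ a : Bits (Finset (Fin n ⊕ Fin m)),
      ∑ b : Bits (Finset (Fin n ⊕ Fin m)), ∑ x : Bits (Fin n), ∑ o' : Bits (Fin m),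
      if y = (fun j => v (Sum.inr j)) then if x = (fun i => out (Sum.inl i)) then
        if o' = o then if (fun i => out (Sum.inl i)) = (fun i => v (Sum.inl i)) then
          (1 / 2) ^ Fintype.card (PhaseMeas n m) *
          (∏ i, cz (leafParity sB (Sum.inl i)) (v (Sum.inl i))) *
          (∏ j, cz (sY j) (o j) * cz (sY j) (v (Sum.inr j))) *
          ((∏ j, cz (v (Sum.inr j)) (w j) * cz (w j) (o j) * cz (sW j) (w j)) *
          ∏ S, cz (a S) (b S) * cz (a S) (parity S (Sum.elim (fun i => v (Sum.inl i)) w)) *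
            (cz (sA S) (a S) * (cz (sB S) (b S) * if b S then
              Complex.exp (-(Complex.I * (sgn (sA S) * (2 * gadgetAngle c sY S)))) else 1)))
        else 0 else 0 else 0 else 0
  · refine Finset.sum_congr rfl fun y _ => Finset.sum_congr rfl fun w _ =>
      Finset.sum_congr rfl fun a _ => Finset.sum_congr rfl fun b _ =>
      Finset.sum_congr rfl fun x _ => Finset.sum_congr rfl fun o' _ => ?_
    refine (congrArg₂ (· * ·) (congrArg₂ (· * ·) (congrArg₂ (· * ·)
      (phasePattern_correct c sY sW sA sB x o' out)
      (phasePattern_prod_braMeas c sY sW sA sB y w a b x o'))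
      (@phaseGraph_prod_edges n m y w a b x o' _ _))
      (if_congr (phasePattern_input c y w a b x o' v) rfl rfl)).trans ?_
    by_cases hy : y = fun j => v (Sum.inr j)
    · by_cases hx : x = fun i => out (Sum.inl i)
      · by_cases ho' : o' = o
        · by_cases hv : (fun i => out (Sum.inl i)) = fun i => v (Sum.inl i)
          · have hxv := hx.trans hv
            rw [if_pos ⟨hx, ho'⟩, if_pos ⟨hy, hxv⟩, if_pos hy, if_pos hx, if_pos ho', if_pos hv,
              ← hhalf, mul_pow]
            subst hy ho' hxv
            simp only [Finset.prod_mul_distrib, gadgetAngle]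
            ring
          · have h : ¬(y = (fun j => v (Sum.inr j)) ∧ x = fun i => v (Sum.inl i)) :=
              fun h => hv (hx.symm.trans h.2)
            rw [if_neg h]
            simp [hv]
        · rw [if_neg fun h => ho' h.2]
          simp [ho']
      · rw [if_neg fun h => hx h.1]
        simp [hx]
    · have h : ¬(y = (fun j => v (Sum.inr j)) ∧ x = fun i => v (Sum.inl i)) :=
        fun h => hy h.1
      rw [if_neg h]
      simp [hy]
  · rw [Fintype.sum_eq_single (fun j => v (Sum.inr j)) fun y hy => by simp [hy]]
    simp only [if_true, Finset.sum_ite_irrel, Finset.sum_const_zero, Finset.sum_ite_eq',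
      Finset.mem_univ]
    refine if_congr Iff.rfl ?_ rfl
    rw [Finset.mul_sum]
    refine Finset.sum_congr rfl fun w _ => ?_
    simp_rw [← Finset.mul_sum]
    congr 2
    -- Reading `gadget_sum` backwards gives a product over `S` of sums over two bits, which expands
    -- to the sum over all `a` and `b`.
    simp_rw [← gadget_sum]
    rw [Finset.prod_univ_sum]
    simp_rw [Finset.prod_univ_sum]
    simp only [Fintype.piFinset_univ]

/-! ### The oracle phase and the scalars of the branches. -/

/-- The oracle phase `π · y·f(x)`. -/
def oraclePhase (f : Bits (Fin n) → Bits (Fin m)) (z : Bits (Fin n ⊕ Fin m)) : ℝ :=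
  ∑ j, if f (fun i => z (Sum.inl i)) j && z (Sum.inr j) then Real.pi else 0

theorem exp_oraclePhase (f : Bits (Fin n) → Bits (Fin m)) (z : Bits (Fin n ⊕ Fin m)) :
    Complex.exp (Complex.I * (oraclePhase f z : ℝ)) =
      ∏ j, cz (f (fun i => z (Sum.inl i)) j) (z (Sum.inr j)) := by
  rw [oraclePhase, Complex.ofReal_sum, Finset.mul_sum, Complex.exp_sum]
  refine Finset.prod_congr rfl fun j _ => ?_
  cases f (fun i => z (Sum.inl i)) j <;> cases z (Sum.inr j) <;>
    simp [mul_comm Complex.I, Complex.exp_pi_mul_I]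

theorem norm_exp_gadget (a : Bool) (t : ℝ) :
    ‖Complex.exp (-(Complex.I * (sgn a * t)))‖ = 1 := by
  cases a <;> simp [Complex.norm_exp]

/-- The scalar by which a branch differs from the oracle. -/
def branchScalar : ℂ :=
  (1 / 2) ^ Fintype.card (PhaseMeas n m) *
    (∏ S, (2 * (Complex.exp (-(Complex.I * (sgn (sA S) * gadgetAngle c sY S))) *
      cz (sB S) (sA S)))) *
    ∏ j, 2 * cz (sY j) (xor (sW j) (leafParity sB (Sum.inr j)))

/-- Each gadget and each `j` contributes two measured qubits, hence `1/4`, and one factor 2 from its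
sum. -/
theorem norm_branchScalar : ‖branchScalar c sY sW sA sB‖ =
    (1 / 2) ^ (m + Fintype.card (Finset (Fin n ⊕ Fin m))) := by
  have h : ‖branchScalar c sY sW sA sB‖ = (1 / 2) ^ Fintype.card (PhaseMeas n m) *
      2 ^ Fintype.card (Finset (Fin n ⊕ Fin m)) * 2 ^ m := by
    simp [branchScalar, norm_prod, norm_cz, norm_exp_gadget, -Fintype.card_finset]
  rw [h, card_phaseMeas, two_mul, pow_add, mul_assoc, mul_assoc, ← pow_add, add_comm _ m,
    ← mul_pow]
  norm_num

theorem branchScalar_mul_star :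
    branchScalar c sY sW sA sB * star (branchScalar c sY sW sA sB) =
      (1 / 2) ^ Fintype.card (PhaseMeas n m) := by
  rw [Complex.star_def, Complex.mul_conj', norm_branchScalar, card_phaseMeas]
  push_cast
  rw [← pow_mul, mul_comm 2]

theorem phasePattern_branch_oracle (f : Bits (Fin n) → Bits (Fin m)) :
    (phasePattern n m (walshCoeff (oraclePhase f))).branch (outcomes sY sW sA sB) =
      branchScalar (walshCoeff (oraclePhase f)) sY sW sA sB • oracle f := by
  ext out v
  rw [phasePattern_branch, Matrix.smul_apply, smul_eq_mul, oracle, Matrix.of_apply]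
  have hout : out = oracleMap f v ↔ (fun i => out (Sum.inl i)) = (fun i => v (Sum.inl i)) ∧
      ∀ j, out (Sum.inr j) = xor (v (Sum.inr j)) (f (fun i => v (Sum.inl i)) j) := by
    simp [funext_iff, oracleMap]
  by_cases hx : (fun i => out (Sum.inl i)) = fun i => v (Sum.inl i)
  · rw [if_pos hx]
    have hw : ∀ w : Bits (Fin m),
        ∏ S, (2 * (Complex.exp (-(Complex.I *
            (sgn (sA S) * gadgetAngle (walshCoeff (oraclePhase f)) sY S))) * cz (sB S) (sA S)) *
          (cz (sB S) (parity S (Sum.elim (fun i => v (Sum.inl i)) w)) *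
            Complex.exp (Complex.I * (gadgetAngle (walshCoeff (oraclePhase f)) sY S *
              sgn (parity S (Sum.elim (fun i => v (Sum.inl i)) w)))))) =
        (∏ S, (2 * (Complex.exp (-(Complex.I *
            (sgn (sA S) * gadgetAngle (walshCoeff (oraclePhase f)) sY S))) *
              cz (sB S) (sA S)))) *
          (∏ i, cz (leafParity sB (Sum.inl i)) (v (Sum.inl i))) *
          ∏ j, cz (leafParity sB (Sum.inr j)) (w j) *
            cz (f (fun i => v (Sum.inl i)) j) (xor (w j) (sY j)) := by
      intro w
      rw [Finset.prod_mul_distrib, Finset.prod_mul_distrib (f := fun S =>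
        cz (sB S) (parity S (Sum.elim (fun i => v (Sum.inl i)) w))), prod_exp_gadgetAngle,
        sum_walshCoeff_mul_walsh, exp_oraclePhase, prod_cz_parity, Fintype.prod_sum_type]
      simp only [Finset.prod_mul_distrib, Sum.elim_inl, Sum.elim_inr, Bool.xor_false]
      ring
    simp_rw [hw]
    -- On the `x`-register the leaf byproducts meet their own corrections.
    have hB : (∏ i, cz (leafParity sB (Sum.inl i)) (v (Sum.inl i))) *
        (∏ i, cz (leafParity sB (Sum.inl i)) (v (Sum.inl i))) = 1 := by
      rw [← Finset.prod_mul_distrib]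
      exact Finset.prod_eq_one fun i _ => by cases v (Sum.inl i) <;> simp [sgn_mul_self]
    have hj := fun j => hadamard_sum (v (Sum.inr j)) (out (Sum.inr j)) (sY j) (sW j)
      (leafParity sB (Sum.inr j)) (f (fun i => v (Sum.inl i)) j)
    have hp := Finset.prod_congr (rfl : (Finset.univ : Finset (Fin m)) = _) fun j _ => hj j
    -- The product over `j` of one-bit sums becomes the sum over the whole register `w`, and the
    -- conditions `q = y ⊕ f` merge into one.
    rw [Finset.prod_mul_distrib, Finset.prod_univ_sum, Finset.prod_ite_zero] at hp
    have hif : _ = if out = oracleMap f v then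
        ∏ j, 2 * cz (sY j) (xor (sW j) (leafParity sB (Sum.inr j))) else 0 :=
      hp.trans (by by_cases h : out = oracleMap f v <;> simp_all)
    rw [branchScalar, mul_assoc _ (∏ j, 2 * _), mul_ite, mul_one, mul_zero, ← hif,
      Fintype.piFinset_univ, Finset.mul_sum, Finset.mul_sum, Finset.mul_sum]
    refine Finset.sum_congr rfl fun w _ => ?_
    simp only [Finset.prod_mul_distrib] at hB ⊢
    -- The sides differ only by the square in `hB`; the coefficient is their common factor.
    linear_combination ((1 / 2) ^ Fintype.card (PhaseMeas n m) *
      (∏ j, cz (sY j) (xor (out (Sum.inr j)) (xor (sW j) (leafParity sB (Sum.inr j))))) *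
      (∏ j, cz (sY j) (v (Sum.inr j))) * (∏ j, cz (v (Sum.inr j)) (w j)) *
      (∏ j, cz (w j) (xor (out (Sum.inr j)) (xor (sW j) (leafParity sB (Sum.inr j))))) *
      (∏ j, cz (sW j) (w j)) * (∏ _S : Finset (Fin n ⊕ Fin m), (2 : ℂ)) *
      (∏ S, Complex.exp (-(Complex.I *
            (sgn (sA S) * gadgetAngle (walshCoeff (oraclePhase f)) sY S)))) *
      (∏ S, cz (sB S) (sA S)) * (∏ j, cz (leafParity sB (Sum.inr j)) (w j)) *
      ∏ j, cz (f (fun i => v (Sum.inl i)) j) (xor (w j) (sY j))) * hB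
  · rw [if_neg hx, if_neg fun h => hx (hout.mp h).1, mul_zero]

theorem phasePattern_implements_oracle (f : Bits (Fin n) → Bits (Fin m)) :
    (phasePattern n m (walshCoeff (oraclePhase f))).Implements (oracle f) := by
  refine Pattern.implements_of_branch _ _ fun s => ?_
  obtain ⟨sY, sW, sA, sB, rfl⟩ := exists_eq_outcomes s
  exact ⟨_, branchScalar_mul_star _ sY sW sA sB, phasePattern_branch_oracle sY sW sA sB f⟩

end

end MBQC

end

theorem mainTheorem1 :
    ∃ d : ℕ, ∀ (n m : ℕ) (f : MBQC.Bits (Fin n) → MBQC.Bits (Fin m)),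
      ∃ P : MBQC.Pattern (Fin n ⊕ Fin m) (Fin n ⊕ Fin m),
        P.depth ≤ (d : ℕ∞) ∧ P.Implements (MBQC.oracle f) :=
  ⟨3, fun _ _ f => ⟨_, MBQC.phasePattern_depth _, MBQC.phasePattern_implements_oracle f⟩⟩
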